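/- Let $\Lambda=\mathbb{Z}\lambda_1+\mathbb{Z}\lambda_2\subset\mathbb{C}$ be a lattice ($\lambda_1,\lambda_2$ linearly independent over $\mathbb{R}$), let $\mathcal{K}_\Lambda$ be the field of elliptic functions (meromorphic functions on $\mathbb{C}$ with periods $\lambda_1,\lambda_2$), and let $$\zeta(z)=\frac1z+\sum_{0\ne\lambda\in\Lambda}\left(\frac1{z-\lambda}+\frac1\lambda+\frac z{\lambda^2}\right)$$ be the Weierstrass zeta function of $\Lambda$. Fix $s\in\mathbb{C}\setminus\mathbb{Q}\Lambda$ and let $\tau(f)(z)=f(z+s)$. An analytic pinning $\mathcal{R}$ is a choice of a representative $q_\omega\in\omega$ for every orbit $\omega\in\mathbb{C}/(\Lambda\oplus\mathbb{Z}s)$, such that the representative of the orbit of $0$ is $0$. For $f\in\mathcal{K}_\Lambda$, $\alpha\in\mathbb{C}$ and $j\ge1$, let $c_j(f,\alpha)$ be the coefficient of $(z-\alpha)^{-j}$ in the Laurent expansion of $f$ at $\alpha$. **Theorem.** Let $f\in\mathcal{K}_\Lambda$ and let $\mathcal{R}$ be an analytic pinning. Then only finitely many of the coefficients $c_j(f,q_\omega+ns)$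 ($\omega\in\mathbb{C}/(\Lambda\oplus\mathbb{Z}s)$, $n\in\mathbb{Z}$, $j\ge1$) are nonzero, and there is a constant $C_{\mathcal{R}}(f)\in\mathbb{C}$ (necessarily unique) such that $$f(z)=C_{\mathcal{R}}(f)+\sum_{\omega}\sum_{n\in\mathbb{Z}}\sum_{j\ge1}\frac{c_j(f,q_\omega+ns)(-1)^{j-1}}{(j-1)!}\,\zeta^{(j-1)}(z-q_\omega-ns).$$ Put $$\operatorname{pano}_{\mathcal{R}}(f,0)=C_{\mathcal{R}}(f),\qquad \operatorname{pano}_{\mathcal{R}}(f,1)=\sum_{\omega}\sum_{n\in\mathbb{Z}}n\,c_1(f,q_\omega+ns),\qquad \operatorname{ores}(f,\omega,j)=\sum_{n\in\mathbb{Z}}c_j(f,q+ns),$$ where $q$ is any representative of $\omega$ (the value does not depend on the choice). Then there exists $g\in\mathcal{K}_\Lambda$ such that $$f-(\tau(g)-g)=\operatorname{pano}_{\mathcal{R}}(f,0)+\operatorname{pano}_{\mathcal{R}}(f,1)\bigl(\zeta(z-s)-\zeta(z)\bigr)+\sum_{\omega}\sum_{j\ge1}\frac{\operatorname{ores}(f,\omega,j)(-1)^{j-1}}{(j-1)!}\,\zeta^{(j-1)}(z-q_\omega).$$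 All identities are identities of meromorphic functions on $\mathbb{C}$. -/

import Mathlib

noncomputable section

namespace EllipticSummability

/-- `f` is elliptic for the lattice `Λ = ℤ ω₁ + ℤ ω₂`: a meromorphic function on `ℂ` with periods
`ω₁` and `ω₂`. Meromorphic functions are represented by functions `ℂ → ℂ`; identities between them
are stated off a closed discrete set (`Filter.codiscrete ℂ`), so values at poles are irrelevant. -/
structure IsElliptic (L : PeriodPair) (f : ℂ → ℂ) : Prop where
  meromorphic : Meromorphic f
  periodic_ω₁ : Function.Periodic f L.ω₁
  periodic_ω₂ : Function.Periodic f L.ω₂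

/-- The shift automorphism `τ : f(z) ↦ f(z + s)`. -/
def shift (s : ℂ) (f : ℂ → ℂ) : ℂ → ℂ := fun z => f (z + s)

/-- The Weierstrass zeta function
`ζ(z) = 1/z + ∑_{0 ≠ l ∈ Λ} (1/(z - l) + 1/l + z/l²)`. -/
def weierstrassZeta (L : PeriodPair) (z : ℂ) : ℂ :=
  1 / z + ∑' l : {l : L.lattice // l ≠ 0},
    (1 / (z - (l.1 : ℂ)) + 1 / (l.1 : ℂ) + z / (l.1 : ℂ) ^ 2)

/-- The subgroup `Λ + ℤ s` of `ℂ`. -/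
def orbitSubgroup (L : PeriodPair) (s : ℂ) : AddSubgroup ℂ :=
  L.lattice.toAddSubgroup ⊔ AddSubgroup.zmultiples s

/-- The set `ℂ / (Λ + ℤ s)` of orbits. -/
abbrev Orbit (L : PeriodPair) (s : ℂ) : Type := ℂ ⧸ orbitSubgroup L s

/-- An analytic pinning: a representative `q_ω ∈ ω` of every orbit `ω`, where `0` is one of the
chosen representatives, that is, `q_ω = 0` for the orbit `ω` of `0`. -/
structure AnalyticPinning (L : PeriodPair) (s : ℂ) where
  rep : Orbit L s → ℂ
  mk_rep : ∀ ω : Orbit L s, (QuotientAddGroup.mk (rep ω) : Orbit L s) = ω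
  rep_zero : rep 0 = 0

/-- The order of the pole of `f` at `α` (`0` if `f` has no pole at `α`). -/
def poleOrder (f : ℂ → ℂ) (α : ℂ) : ℕ := (-(meromorphicOrderAt f α).untop₀).toNat

/-- `c_j(f, α)`, for `j ≥ 1`: the coefficient of `(z - α)^(-j)` in the Laurent expansion of `f`
at `α`. With `k` the pole order, `(z - α)^k f(z)` extends analytically to `α`, and `c_j(f, α)` is
its Taylor coefficient of index `k - j` (and `0` if `j > k`). -/
def polarCoeff (f : ℂ → ℂ) (α : ℂ) (j : ℕ) : ℂ :=
  if j ≤ poleOrder f α then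
    iteratedDeriv (poleOrder f α - j)
      (toMeromorphicNFAt (fun z => (z - α) ^ poleOrder f α * f z) α) α
        / ((poleOrder f α - j).factorial : ℂ)
  else 0

/-- The non-constant part of the `ζ`-expansion of `f` relative to the pinning `R`:
`∑_ω ∑_{n ∈ ℤ} ∑_{j ≥ 1} c_j(f, q_ω + n s) (-1)^(j-1) / (j-1)! · ζ^(j-1)(z - q_ω - n s)`. -/
def zetaSum {L : PeriodPair} {s : ℂ} (R : AnalyticPinning L s) (f : ℂ → ℂ) (z : ℂ) : ℂ :=
  ∑ᶠ (ω : Orbit L s) (n : ℤ) (j : ℕ) (_ : 1 ≤ j),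
    polarCoeff f (R.rep ω + n * s) j * (-1) ^ (j - 1) / ((j - 1).factorial : ℂ) *
      iteratedDeriv (j - 1) (weierstrassZeta L) (z - R.rep ω - n * s)

/-- The constant term `C_R(f)` of the `ζ`-expansion of `f` relative to `R`: the constant `C` with
`f(z) = C + zetaSum R f z` as meromorphic functions. -/
def zetaConst {L : PeriodPair} {s : ℂ} (R : AnalyticPinning L s) (f : ℂ → ℂ) : ℂ :=
  Classical.epsilon fun C : ℂ => f =ᶠ[Filter.codiscrete ℂ] fun z => C + zetaSum R f z

/-- The orbital residue `ores(f, ω, j) = ∑_{n ∈ ℤ} c_j(f, q + n s)`, for any choice of a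
representative `q` of `ω`. -/
def ores {L : PeriodPair} {s : ℂ} (f : ℂ → ℂ) (ω : Orbit L s) (j : ℕ) : ℂ :=
  ∑ᶠ n : ℤ, polarCoeff f (ω.out + n * s) j

/-- The panorbital residue of order `0` relative to `R`. -/
def pano₀ {L : PeriodPair} {s : ℂ} (R : AnalyticPinning L s) (f : ℂ → ℂ) : ℂ :=
  zetaConst R f

/-- The panorbital residue of order `1` relative to `R`: `∑_ω ∑_{n ∈ ℤ} n · c_1(f, q_ω + n s)`. -/
def pano₁ {L : PeriodPair} {s : ℂ} (R : AnalyticPinning L s) (f : ℂ → ℂ) : ℂ :=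
  ∑ᶠ (ω : Orbit L s) (n : ℤ), (n : ℂ) * polarCoeff f (R.rep ω + n * s) 1

end EllipticSummability

end

open EllipticSummability

/-!
Every elliptic function is, up to an additive constant, a finite combination of translates of `ζ`
and its derivatives, and the reduction is obtained by moving each translate along its orbit.

*The expansion.* Off a discrete set the lattice translates `ζ` by constants
(`weierstrassZeta_add`), because `ζ' = -℘` is periodic and the complement of the lattice is
connected. The function `zetaBlock L j = (-1)^(j-1)/(j-1)! · ζ^(j-1)` has polar part `(z - l)^(-j)`
at every lattice point `l` (`removable_zetaBlock_sub`). As `s ∉ ℚΛ`, every point of `ℂ` is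
congruent modulo `Λ` to exactly one pinned point `q_ω + n s`
(`exists_sub_point_mem_lattice`, `point_injective_mod_lattice`). So subtracting from `f` the
translated blocks with the coefficients `c_j(f, q_ω + n s)` leaves a function `h` with removable
singularities only, which satisfies `h(z + l) = h(z) - ρ η(l)`, where `ρ` is the sum of the
residues and `η(l)` the quasi-period. By Liouville's theorem `h'` is constant, so `h = a z + b`
with `a l = -ρ η(l)` (`eq_affine_of_removable_of_quasiPeriodic`).

*The residue sum vanishes.* Contour integration is replaced by an algebraic argument. If `ρ ≠ 0`,
then `η(l)` is a constant multiple of `l`, so some `F = ζ - c z` is elliptic. It is odd, hence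
vanishes at the half periods, so `F(z) F(z + ω₁/2)` has no poles and is constant; the constant is
`0`, its value at `ω₂/2`, contradicting the pole of `F` at `0` (`quasiPeriod_ne_mul`). Therefore
`ρ = 0` and `a = 0`, and `h` is the constant of the expansion (`exists_zeta_expansion`).

*The reduction.* Call `u` summable if `u = τ(g) - g` with `g` elliptic. For a block with pole
`q + n s`, replacing `n` by `n + 1` changes it by `ψ(z - s) - ψ(z)` with `ψ` the block itself, up
to `ζ(z - s) - ζ(z)` when `j = 1`, where `ψ` is corrected by `-ζ` to become elliptic. Hence the
block with pole `q + n s` equals the block with pole `q`, plus `n (ζ(z - s) - ζ(z))` if `j = 1`,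
plus a summable function (`isSummable_zetaBlock_sub`). Summing over all poles collects the
coefficients into the orbital residues and the panorbital residue of order `1`.
-/

noncomputable section

namespace EllipticSummability

open Filter Topology

/-! ### Identities off a closed discrete set -/

theorem eventuallyEq_codiscrete_iff {u v : ℂ → ℂ} :
    u =ᶠ[codiscrete ℂ] v ↔ ∀ x, u =ᶠ[𝓝[≠] x] v := by
  rw [EventuallyEq, Filter.Eventually, mem_codiscrete]
  refine forall_congr' fun x => ?_
  rw [disjoint_principal_right, compl_compl]
  rfl

theorem eventuallyEq_nhdsNE_comp_add {u v : ℂ → ℂ} {x a : ℂ} (h : u =ᶠ[𝓝[≠] (x + a)] v) :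
    (fun z => u (z + a)) =ᶠ[𝓝[≠] x] fun z => v (z + a) := by
  have ht : Tendsto (fun z : ℂ => z + a) (𝓝[≠] x) (𝓝[≠] (x + a)) := by
    refine tendsto_nhdsWithin_of_tendsto_nhds_of_eventually_within _ ?_ ?_
    · exact ((continuous_add_const a).tendsto x).mono_left nhdsWithin_le_nhds
    · filter_upwards [self_mem_nhdsWithin] with z hz
      simpa using hz
  exact ht.eventually h

theorem eventuallyEq_codiscrete_comp_add {u v : ℂ → ℂ} (h : u =ᶠ[codiscrete ℂ] v) (a : ℂ) :
    (fun z => u (z + a)) =ᶠ[codiscrete ℂ] fun z => v (z + a) :=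
  eventuallyEq_codiscrete_iff.2 fun x =>
    eventuallyEq_nhdsNE_comp_add (eventuallyEq_codiscrete_iff.1 h (x + a))

/-! ### Removable singularities and the polar part at a point -/

/-- `h` has at most a removable singularity at `x`: near `x`, but possibly not at `x` itself, it
agrees with a function that is analytic at `x`. -/
def Removable (h : ℂ → ℂ) (x : ℂ) : Prop :=
  ∃ g : ℂ → ℂ, AnalyticAt ℂ g x ∧ h =ᶠ[𝓝[≠] x] g

theorem _root_.AnalyticAt.removable {h : ℂ → ℂ} {x : ℂ} (hh : AnalyticAt ℂ h x) : Removable h x :=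
  ⟨h, hh, .rfl⟩

namespace Removable

variable {u v : ℂ → ℂ} {x : ℂ}

theorem congr (hu : Removable u x) (h : u =ᶠ[𝓝[≠] x] v) : Removable v x := by
  obtain ⟨g, hg, hug⟩ := hu
  exact ⟨g, hg, h.symm.trans hug⟩

theorem add (hu : Removable u x) (hv : Removable v x) : Removable (fun z => u z + v z) x := by
  obtain ⟨g, hg, hug⟩ := hu
  obtain ⟨k, hk, hvk⟩ := hv
  exact ⟨fun z => g z + k z, hg.add hk, hug.add hvk⟩

theorem sub (hu : Removable u x) (hv : Removable v x) : Removable (fun z => u z - v z) x := by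
  obtain ⟨g, hg, hug⟩ := hu
  obtain ⟨k, hk, hvk⟩ := hv
  exact ⟨fun z => g z - k z, hg.sub hk, hug.sub hvk⟩

theorem const_mul (hu : Removable u x) (c : ℂ) : Removable (fun z => c * u z) x := by
  obtain ⟨g, hg, hug⟩ := hu
  exact ⟨fun z => c * g z, analyticAt_const.mul hg, hug.fun_comp (c * ·)⟩

theorem sum {ι : Type*} {s : Finset ι} {F : ι → ℂ → ℂ} (h : ∀ i ∈ s, Removable (F i) x) :
    Removable (fun z => ∑ i ∈ s, F i z) x := by
  classical
  induction s using Finset.induction_on with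
  | empty => simpa using (analyticAt_const (v := (0 : ℂ))).removable
  | insert a s ha ih =>
    simp only [Finset.sum_insert ha]
    exact (h a (by simp)).add (ih fun i hi => h i (by simp [hi]))

theorem deriv (hu : Removable u x) : Removable (deriv u) x := by
  obtain ⟨g, hg, hug⟩ := hu
  exact ⟨_, hg.deriv, hug.nhdsNE_deriv⟩

theorem comp_add {a : ℂ} (hu : Removable u (x + a)) : Removable (fun z => u (z + a)) x := by
  obtain ⟨g, hg, hug⟩ := hu
  exact ⟨fun z => g (z + a), hg.comp_of_eq (by fun_prop) rfl, eventuallyEq_nhdsNE_comp_add hug⟩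

theorem meromorphicAt (hu : Removable u x) : MeromorphicAt u x := by
  obtain ⟨g, hg, hug⟩ := hu
  exact (MeromorphicAt.meromorphicAt_congr hug).2 hg.meromorphicAt

theorem order_nonneg (hu : Removable u x) : 0 ≤ meromorphicOrderAt u x :=
  hu.meromorphicAt.meromorphicOrderAt_nonneg_iff.2 hu

end Removable

theorem analyticAt_toMeromorphicNFAt {u : ℂ → ℂ} {x : ℂ} (hu : Removable u x) :
    AnalyticAt ℂ (toMeromorphicNFAt u x) x :=
  hu.meromorphicAt.meromorphicOrderAt_nonneg_iff_analyticAt_toMeromorphicNFAt.1 hu.order_nonneg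

/-- Division of an analytic function by `(z - a) ^ k`, with the Taylor polynomial as remainder. -/
theorem exists_taylor_add_pow_mul {G : ℂ → ℂ} {a : ℂ} (hG : AnalyticAt ℂ G a) (k : ℕ) :
    ∃ Q : ℂ → ℂ, AnalyticAt ℂ Q a ∧ ∀ z, G z =
      ∑ i ∈ Finset.range k, iteratedDeriv i G a / (i.factorial : ℂ) * (z - a) ^ i
        + (z - a) ^ k * Q z := by
  have hp := hG.hasFPowerSeriesAt
  refine ⟨(Function.swap dslope a)^[k] G,
    (hp.has_fpower_series_iterate_dslope_fslope k).analyticAt, fun z => ?_⟩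
  induction k with
  | zero => simp
  | succ k ih =>
    rw [ih, Finset.sum_range_succ, Function.iterate_succ_apply']
    have h0 := (hp.has_fpower_series_iterate_dslope_fslope k).coeff_zero 1
    rw [← FormalMultilinearSeries.coeff, FormalMultilinearSeries.coeff_iterate_fslope,
      FormalMultilinearSeries.coeff_ofScalars, zero_add] at h0
    have h1 := sub_smul_dslope ((Function.swap dslope a)^[k] G) a z
    rw [← h0, smul_eq_mul] at h1
    rw [Function.swap]
    linear_combination (-(z - a) ^ k) * h1

theorem neg_poleOrder_le_order (f : ℂ → ℂ) (x : ℂ) :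
    ((-(poleOrder f x : ℤ) : ℤ) : WithTop ℤ) ≤ meromorphicOrderAt f x := by
  rw [poleOrder]
  induction meromorphicOrderAt f x with
  | top => exact le_top
  | coe n => simp only [WithTop.untop₀_coe, WithTop.coe_le_coe]; omega

theorem removable_pow_mul {f : ℂ → ℂ} {x : ℂ} (hf : MeromorphicAt f x) :
    Removable (fun z => (z - x) ^ poleOrder f x * f z) x := by
  have hp : MeromorphicAt (fun z : ℂ => z - x) x := by fun_prop
  have h1 : MeromorphicAt (fun z : ℂ => (z - x) ^ poleOrder f x) x := hp.pow _
  refine (h1.mul hf).meromorphicOrderAt_nonneg_iff.1 ?_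
  rw [meromorphicOrderAt_mul h1 hf]
  have h2 : meromorphicOrderAt (fun z : ℂ => (z - x) ^ poleOrder f x) x
      = ((poleOrder f x : ℤ) : WithTop ℤ) := by
    refine (meromorphicOrderAt_eq_int_iff h1).2 ⟨fun _ => 1, analyticAt_const, one_ne_zero, ?_⟩
    simp
  rw [h2]
  have := neg_poleOrder_le_order f x
  calc (0 : WithTop ℤ) = ((poleOrder f x : ℤ) : WithTop ℤ) + ((-(poleOrder f x : ℤ) : ℤ)) := by
        rw [← WithTop.coe_add]; simp
    _ ≤ _ := by gcongr

theorem polarCoeff_of_lt {f : ℂ → ℂ} {x : ℂ} {j : ℕ} (h : poleOrder f x < j) :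
    polarCoeff f x j = 0 := by
  rw [polarCoeff, if_neg (by omega)]

/-- Subtracting the polar part, written with the coefficients `polarCoeff`, removes the
singularity. -/
theorem removable_sub_polarPart {f : ℂ → ℂ} {x : ℂ} (hf : MeromorphicAt f x) {N : ℕ}
    (hN : poleOrder f x ≤ N) :
    Removable (fun z => f z - ∑ j ∈ Finset.Icc 1 N, polarCoeff f x j * ((z - x) ^ j)⁻¹) x := by
  set k := poleOrder f x with hk
  have hr := removable_pow_mul hf
  rw [← hk] at hr
  obtain ⟨Q, hQ, hGQ⟩ := exists_taylor_add_pow_mul (analyticAt_toMeromorphicNFAt hr) k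
  refine ⟨Q, hQ, ?_⟩
  filter_upwards [hr.meromorphicAt.eq_nhdsNE_toMeromorphicNFAt, self_mem_nhdsWithin] with z hz hzx
  have hzx : z - x ≠ 0 := sub_ne_zero.2 hzx
  have hsum : ∑ j ∈ Finset.Icc 1 N, polarCoeff f x j * ((z - x) ^ j)⁻¹ =
      ∑ j ∈ Finset.Icc 1 k, polarCoeff f x j * ((z - x) ^ j)⁻¹ := by
    refine (Finset.sum_subset (Finset.Icc_subset_Icc_right hN) fun j hj hj' => ?_).symm
    rw [polarCoeff_of_lt, zero_mul]
    simp only [Finset.mem_Icc] at hj hj'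
    omega
  rw [hGQ z] at hz
  have hre : ∑ j ∈ Finset.Icc 1 k, polarCoeff f x j * (z - x) ^ (k - j) =
      ∑ i ∈ Finset.range k, iteratedDeriv i (toMeromorphicNFAt (fun z => (z - x) ^ k * f z) x) x
        / (i.factorial : ℂ) * (z - x) ^ i := by
    refine Finset.sum_bij' (fun j _ => k - j) (fun i _ => k - i) ?_ ?_ ?_ ?_ ?_
    · simp only [Finset.mem_Icc, Finset.mem_range]; omega
    · simp only [Finset.mem_Icc, Finset.mem_range]; omega
    · simp only [Finset.mem_Icc]; omega
    · simp only [Finset.mem_range]; omega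
    · intro j hj
      rw [polarCoeff, if_pos (Finset.mem_Icc.1 hj).2]
  rw [← hre] at hz
  rw [hsum]
  have hm : (z - x) ^ k * ∑ j ∈ Finset.Icc 1 k, polarCoeff f x j * ((z - x) ^ j)⁻¹ =
      ∑ j ∈ Finset.Icc 1 k, polarCoeff f x j * (z - x) ^ (k - j) := by
    rw [Finset.mul_sum]
    refine Finset.sum_congr rfl fun j hj => ?_
    rw [← Nat.sub_add_cancel (Finset.mem_Icc.1 hj).2, pow_add, Nat.add_sub_cancel]
    field_simp
  refine mul_left_cancel₀ (pow_ne_zero k hzx) ?_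
  rw [mul_sub, hm, hz]
  ring

theorem poleOrder_comp_add (f : ℂ → ℂ) (a x : ℂ) :
    poleOrder (fun z => f (z + a)) x = poleOrder f (x + a) := by
  rw [poleOrder, poleOrder, ← meromorphicOrderAt_comp_add_const_eq_meromorphicOrderAt]
  rfl

theorem polarCoeff_comp_add {f : ℂ → ℂ} (hf : Meromorphic f) (a x : ℂ) (j : ℕ) :
    polarCoeff (fun z => f (z + a)) x j = polarCoeff f (x + a) j := by
  rw [polarCoeff, polarCoeff, poleOrder_comp_add]
  set k := poleOrder f (x + a)
  set F : ℂ → ℂ := fun z => (z - (x + a)) ^ k * f z with hF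
  have hFm : MeromorphicAt F (x + a) := by
    have h1 : MeromorphicAt (fun z : ℂ => z - (x + a)) (x + a) := by fun_prop
    exact (h1.pow k).mul (hf _)
  have hFa : (fun z => (z - x) ^ k * f (z + a)) = fun z => F (z + a) := by
    funext z
    simp [hF]
  rw [hFa]
  have hm : MeromorphicAt (fun z => F (z + a)) x :=
    MeromorphicAt.comp_analyticAt (g := fun z => z + a) hFm (by fun_prop)
  have heq : toMeromorphicNFAt (fun z => F (z + a)) x =ᶠ[𝓝 x]
      fun z => toMeromorphicNFAt F (x + a) (z + a) := by
    refine (MeromorphicNFAt.eventuallyEq_nhdsNE_iff_eventuallyEq_nhds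
      meromorphicNFAt_toMeromorphicNFAt ?_).1 ?_
    · exact meromorphicNFAt_comp_add_const_iff_meromorphicNFAt.2 meromorphicNFAt_toMeromorphicNFAt
    · exact hm.eq_nhdsNE_toMeromorphicNFAt.symm.trans
        (eventuallyEq_nhdsNE_comp_add hFm.eq_nhdsNE_toMeromorphicNFAt)
  rw [heq.iteratedDeriv_eq, iteratedDeriv_comp_add_const]

/-! ### Normal forms and Liouville's theorem -/

/-- The representative in normal form (in particular, with analytic values at removable
singularities) of a meromorphic function. -/
abbrev normalForm (u : ℂ → ℂ) : ℂ → ℂ := toMeromorphicNFOn u Set.univ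

theorem eq_normalForm {u : ℂ → ℂ} (hu : Meromorphic u) : u =ᶠ[codiscrete ℂ] normalForm u :=
  toMeromorphicNFOn_eqOn_codiscrete (meromorphicOn_univ.2 hu)

theorem meromorphicNFAt_normalForm (u : ℂ → ℂ) (x : ℂ) : MeromorphicNFAt (normalForm u) x :=
  meromorphicNFOn_toMeromorphicNFOn u _ (Set.mem_univ x)

theorem meromorphic_normalForm (u : ℂ → ℂ) : Meromorphic (normalForm u) := fun x =>
  (meromorphicNFAt_normalForm u x).meromorphicAt

theorem analyticAt_normalForm {u : ℂ → ℂ} (hu : ∀ x, Removable u x) (x : ℂ) :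
    AnalyticAt ℂ (normalForm u) x := by
  have hm : Meromorphic u := fun x => (hu x).meromorphicAt
  refine (meromorphicNFAt_normalForm u x).meromorphicOrderAt_nonneg_iff_analyticAt.1 ?_
  rw [← meromorphicOrderAt_congr (eventuallyEq_codiscrete_iff.1 (eq_normalForm hm) x)]
  exact (hu x).order_nonneg

/-- The normal form of a function that is periodic off a discrete set is periodic everywhere. -/
theorem normalForm_periodic {u : ℂ → ℂ} (hu : Meromorphic u) {a : ℂ}
    (h : (fun z => u (z + a)) =ᶠ[codiscrete ℂ] u) : Function.Periodic (normalForm u) a := by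
  intro x
  have h1 : (fun z => normalForm u (z + a)) =ᶠ[codiscrete ℂ] normalForm u :=
    ((eventuallyEq_codiscrete_comp_add (eq_normalForm hu) a).symm.trans h).trans (eq_normalForm hu)
  exact ((MeromorphicNFAt.eventuallyEq_nhdsNE_iff_eventuallyEq_nhds
    (meromorphicNFAt_comp_add_const_iff_meromorphicNFAt.2 (meromorphicNFAt_normalForm u (x + a)))
    (meromorphicNFAt_normalForm u x)).1 (eventuallyEq_codiscrete_iff.1 h1 x)).eq_of_nhds

theorem eq_of_eventuallyEq_codiscrete {u v : ℂ → ℂ} {x : ℂ} (h : u =ᶠ[codiscrete ℂ] v)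
    (hu : ContinuousAt u x) (hv : ContinuousAt v x) : u x = v x := by
  have h1 := eventuallyEq_codiscrete_iff.1 h x
  exact tendsto_nhds_unique (hu.tendsto.mono_left nhdsWithin_le_nhds |>.congr' h1)
    (hv.tendsto.mono_left nhdsWithin_le_nhds)

theorem periodic_of_mem_lattice {L : PeriodPair} {α : Type*} {u : ℂ → α}
    (h₁ : Function.Periodic u L.ω₁) (h₂ : Function.Periodic u L.ω₂) {l : ℂ} (hl : l ∈ L.lattice) :
    Function.Periodic u l := by
  obtain ⟨m, n, rfl⟩ := PeriodPair.mem_lattice.1 hl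
  exact (h₁.int_mul m).add_period (h₂.int_mul n)

/-- Every point of `ℂ` is congruent modulo the lattice to a point of a fixed ball. -/
theorem exists_lattice_sub_mem_closedBall (L : PeriodPair) :
    ∃ r : ℝ, ∀ z : ℂ, ∃ l ∈ L.lattice, z - l ∈ Metric.closedBall (0 : ℂ) r := by
  refine ⟨∑ i, ‖L.basis i‖, fun z => ⟨ZSpan.floor L.basis z, ?_, ?_⟩⟩
  · rw [L.lattice_eq_span_range_basis]
    exact (ZSpan.floor L.basis z).2
  · rw [mem_closedBall_zero_iff, ← ZSpan.fract_apply]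
    exact ZSpan.norm_fract_le L.basis z

theorem eq_const_of_differentiable_of_periodic {L : PeriodPair} {u : ℂ → ℂ}
    (hu : Differentiable ℂ u) (h₁ : Function.Periodic u L.ω₁) (h₂ : Function.Periodic u L.ω₂) :
    ∃ c, ∀ z, u z = c := by
  refine hu.exists_const_forall_eq_of_bounded ?_
  obtain ⟨r, hr⟩ := exists_lattice_sub_mem_closedBall L
  refine ((isCompact_closedBall (0 : ℂ) r).image hu.continuous).isBounded.subset ?_
  rintro _ ⟨z, rfl⟩
  obtain ⟨l, hl, hz⟩ := hr z
  exact ⟨z - l, hz, (periodic_of_mem_lattice h₁ h₂ hl).sub_eq z⟩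

/-- Liouville's theorem for quasi-periodic functions: a function with removable singularities only
that changes by an additive constant under each of the two periods is affine. -/
theorem eq_affine_of_removable_of_quasiPeriodic {L : PeriodPair} {u : ℂ → ℂ}
    (hu : ∀ x, Removable u x) {c₁ c₂ : ℂ}
    (h₁ : (fun z => u (z + L.ω₁)) =ᶠ[codiscrete ℂ] fun z => u z + c₁)
    (h₂ : (fun z => u (z + L.ω₂)) =ᶠ[codiscrete ℂ] fun z => u z + c₂) :
    ∃ a b : ℂ, a * L.ω₁ = c₁ ∧ a * L.ω₂ = c₂ ∧ u =ᶠ[codiscrete ℂ] fun z => a * z + b := by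
  set H := normalForm u with hH
  have hm : Meromorphic u := fun x => (hu x).meromorphicAt
  have huH : u =ᶠ[codiscrete ℂ] H := eq_normalForm hm
  have hd : Differentiable ℂ H := fun x => (analyticAt_normalForm hu x).differentiableAt
  have hquasi : ∀ w c, (fun z => u (z + w)) =ᶠ[codiscrete ℂ] (fun z => u z + c) →
      ∀ z, H (z + w) = H z + c := by
    intro w c h z
    refine eq_of_eventuallyEq_codiscrete (u := fun z => H (z + w)) (v := fun z => H z + c)
      (((eventuallyEq_codiscrete_comp_add huH w).symm.trans h).trans
        (huH.fun_comp (· + c))) ?_ ?_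
    · have := hd.continuous; fun_prop
    · have := hd.continuous; fun_prop
  have hderiv : ∀ w c, (∀ z, H (z + w) = H z + c) → Function.Periodic (deriv H) w := by
    intro w c h z
    rw [← deriv_comp_add_const, funext h, deriv_add_const]
  have hq₁ := hquasi _ _ h₁
  have hq₂ := hquasi _ _ h₂
  obtain ⟨a, ha⟩ := eq_const_of_differentiable_of_periodic (L := L)
    (fun x => (analyticAt_normalForm hu x).deriv.differentiableAt) (hderiv _ _ hq₁) (hderiv _ _ hq₂)
  have hb : ∀ z, H z = a * z + H 0 := by
    intro z
    have := is_const_of_deriv_eq_zero (f := fun z => H z - a * z) (by fun_prop) (fun x => by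
      rw [deriv_fun_sub (hd x) (by fun_prop), ha, deriv_const_mul_field, deriv_id'']
      simp) z 0
    linear_combination this
  refine ⟨a, H 0, ?_, ?_, ?_⟩
  · have := hq₁ 0
    rw [hb, hb 0] at this
    linear_combination this
  · have := hq₂ 0
    rw [hb, hb 0] at this
    linear_combination this
  · rwa [← funext hb]

/-! ### The Weierstrass zeta function -/

theorem norm_zeta_term_le {r : ℝ} (hr : 0 < r) {z l : ℂ} (hz : ‖z‖ < r) (h : 2 * r ≤ ‖l‖) :
    ‖1 / (z - l) + 1 / l + z / l ^ 2‖ ≤ 2 * r ^ 2 * ‖l‖ ^ (-3 : ℝ) := by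
  have hl : 0 < ‖l‖ := by linarith
  have hl0 : l ≠ 0 := norm_pos_iff.1 hl
  have hzl : ‖l‖ / 2 ≤ ‖z - l‖ := by
    have := norm_sub_norm_le l z
    rw [norm_sub_rev] at this
    linarith
  have hzl0 : z - l ≠ 0 := norm_pos_iff.1 (by linarith)
  have he : 1 / (z - l) + 1 / l + z / l ^ 2 = z ^ 2 / (l ^ 2 * (z - l)) := by
    field_simp
    ring
  rw [he, norm_div, norm_mul, norm_pow, norm_pow]
  calc ‖z‖ ^ 2 / (‖l‖ ^ 2 * ‖z - l‖) ≤ r ^ 2 / (‖l‖ ^ 2 * (‖l‖ / 2)) := by gcongr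
    _ = 2 * r ^ 2 / ‖l‖ ^ 3 := by field
    _ = _ := by
      rw [Real.rpow_neg hl.le, div_eq_mul_inv]
      norm_cast

/-- The zeta function without its term `1 / z`, as a sum over the whole lattice. -/
def zetaRegular (L : PeriodPair) (z : ℂ) : ℂ :=
  ∑' l : L.lattice, if l.1 = 0 then 0 else (1 / (z - l.1) + 1 / l.1 + z / l.1 ^ 2)

theorem weierstrassZeta_eq (L : PeriodPair) (z : ℂ) :
    weierstrassZeta L z = 1 / z + zetaRegular L z := by
  rw [weierstrassZeta, zetaRegular]
  congr 1
  refine (tsum_subtype {l : L.lattice | l ≠ 0}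
    (fun l => 1 / (z - (l : ℂ)) + 1 / (l : ℂ) + z / (l : ℂ) ^ 2)).trans ?_
  refine tsum_congr fun l => ?_
  by_cases h : l = 0 <;> simp [h]

theorem hasSumLocallyUniformly_zetaRegular (L : PeriodPair) :
    HasSumLocallyUniformly (fun (l : L.lattice) (z : ℂ) =>
      if l.1 = 0 then 0 else (1 / (z - l.1) + 1 / l.1 + z / l.1 ^ 2)) (zetaRegular L) := by
  refine L.hasSumLocallyUniformly_aux (u := fun r l => 2 * r ^ 2 * ‖l‖ ^ (-3 : ℝ)) _
    (fun _ _ => (ZLattice.summable_norm_rpow _ _ (by simp; norm_num)).mul_left _) fun r hr =>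
    eventually_atTop.mpr ⟨2 * r, ?_⟩
  rintro _ h z hz l rfl
  split_ifs
  · simpa using! show 0 ≤ 2 * r ^ 2 * ‖l‖ ^ (-3 : ℝ) by positivity
  · exact norm_zeta_term_le hr hz h

theorem differentiableOn_zeta_term (L : PeriodPair) (l : L.lattice) :
    DifferentiableOn ℂ (fun z : ℂ =>
      if l.1 = 0 then 0 else (1 / (z - l.1) + 1 / l.1 + z / l.1 ^ 2)) (L.lattice \ {0})ᶜ := by
  split_ifs with h
  · simp
  · have : ∀ x ∈ ((L.lattice : Set ℂ) \ {0})ᶜ, x - l.1 ≠ 0 := by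
      intro x hx e
      exact hx ⟨by rw [sub_eq_zero.1 e]; exact l.2, by rw [sub_eq_zero.1 e]; exact h⟩
    exact ((DifferentiableOn.div (by fun_prop) (by fun_prop) this).add (by fun_prop)).add
      (by fun_prop)

theorem differentiableOn_zetaRegular (L : PeriodPair) :
    DifferentiableOn ℂ (zetaRegular L) (L.lattice \ {0})ᶜ :=
  (hasSumLocallyUniformly_zetaRegular L).hasSumLocallyUniformlyOn.differentiableOn
    (.of_forall fun _ => .fun_sum fun l _ => differentiableOn_zeta_term L l)
    L.isOpen_compl_lattice_sdiff

theorem deriv_zetaRegular (L : PeriodPair) {z : ℂ} (hz : z ∉ (L.lattice : Set ℂ) \ {0}) :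
    deriv (zetaRegular L) z = -L.weierstrassPExcept 0 z := by
  have hneg : TendstoLocallyUniformlyOn
      (fun (s : Finset L.lattice) (z : ℂ) =>
        -∑ l ∈ s, if l.1 = 0 then 0 else (1 / (z - l.1) ^ 2 - 1 / l.1 ^ 2))
      (fun z => -L.weierstrassPExcept 0 z) atTop ((L.lattice : Set ℂ) \ {0})ᶜ :=
    (L.hasSumLocallyUniformly_weierstrassPExcept 0).tendstoLocallyUniformlyOn.neg
  refine ((hasSumLocallyUniformly_zetaRegular L).tendstoLocallyUniformlyOn.deriv
    (.of_forall fun s => .fun_sum fun l _ => differentiableOn_zeta_term L l)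
    L.isOpen_compl_lattice_sdiff).unique (hneg.congr ?_) (x := z) hz
  intro s z hz
  have hd := fun l : L.lattice => (differentiableOn_zeta_term L l).differentiableAt
    (L.isOpen_compl_lattice_sdiff.mem_nhds hz)
  simp only [Function.comp_apply]
  rw [deriv_fun_sum fun l _ => hd l, ← Finset.sum_neg_distrib]
  refine Finset.sum_congr rfl fun l _ => ?_
  split_ifs with hl
  · simp
  have hzl : z - l.1 ≠ 0 := fun e =>
    hz ⟨by rw [sub_eq_zero.1 e]; exact l.2, by rw [sub_eq_zero.1 e]; exact hl⟩
  have h1 : HasDerivAt (fun z : ℂ => 1 / (z - l.1)) (-1 / (z - l.1) ^ 2) z := by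
    simpa only [one_div] using ((hasDerivAt_id' z).sub_const l.1).fun_inv hzl
  have h2 : HasDerivAt (fun z : ℂ => z / l.1 ^ 2) (1 / l.1 ^ 2) z :=
    (hasDerivAt_id z).div_const _
  rw [((h1.add_const (1 / l.1)).fun_add h2).deriv]
  ring

theorem compl_lattice_mem_nhds (L : PeriodPair) {z : ℂ} (hz : z ∉ L.lattice) :
    (L.lattice : Set ℂ)ᶜ ∈ 𝓝 z :=
  L.isClosed_lattice.isOpen_compl.mem_nhds hz

theorem eventually_notMem_lattice (L : PeriodPair) (x : ℂ) : ∀ᶠ z in 𝓝[≠] x, z ∉ L.lattice := by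
  filter_upwards [nhdsWithin_le_nhds (L.compl_lattice_sdiff_singleton_mem_nhds x),
    self_mem_nhdsWithin] with z hz hzx hzL
  exact hz ⟨hzL, hzx⟩

theorem analyticAt_zetaRegular (L : PeriodPair) {z : ℂ} (hz : z ∉ (L.lattice : Set ℂ) \ {0}) :
    AnalyticAt ℂ (zetaRegular L) z :=
  (differentiableOn_zetaRegular L).analyticAt (L.isOpen_compl_lattice_sdiff.mem_nhds hz)

theorem analyticAt_weierstrassZeta (L : PeriodPair) {z : ℂ} (hz : z ∉ L.lattice) :
    AnalyticAt ℂ (weierstrassZeta L) z := by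
  have hz0 : z ≠ 0 := by rintro rfl; exact hz (zero_mem _)
  rw [funext (weierstrassZeta_eq L)]
  exact (analyticAt_const.div analyticAt_id hz0).add (analyticAt_zetaRegular L fun h => hz h.1)

theorem analyticAt_iteratedDeriv_weierstrassZeta (L : PeriodPair) {z : ℂ} (hz : z ∉ L.lattice)
    (k : ℕ) : AnalyticAt ℂ (iteratedDeriv k (weierstrassZeta L)) z := by
  rw [iteratedDeriv_eq_iterate]
  exact (analyticAt_weierstrassZeta L hz).iterated_deriv k

theorem deriv_weierstrassZeta (L : PeriodPair) {z : ℂ} (hz : z ∉ L.lattice) :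
    deriv (weierstrassZeta L) z = -L.weierstrassP z := by
  have hz0 : z ≠ 0 := by rintro rfl; exact hz (zero_mem _)
  have hz' : z ∉ (L.lattice : Set ℂ) \ {0} := fun h => hz h.1
  rw [funext (weierstrassZeta_eq L)]
  have h1 : HasDerivAt (fun z : ℂ => 1 / z) (-1 / z ^ 2) z := by
    simpa only [one_div] using (hasDerivAt_id' z).fun_inv hz0
  have h2 := (analyticAt_zetaRegular L hz').differentiableAt.hasDerivAt
  rw [(h1.fun_add h2).deriv, deriv_zetaRegular L hz', ← L.weierstrassPExcept_add 0 z]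
  simp
  ring

theorem weierstrassZeta_neg (L : PeriodPair) (z : ℂ) :
    weierstrassZeta L (-z) = -weierstrassZeta L z := by
  rw [weierstrassZeta_eq, weierstrassZeta_eq, zetaRegular, ← (Equiv.neg L.lattice).tsum_eq,
    zetaRegular, neg_add, ← tsum_neg]
  congr 1
  · ring
  refine tsum_congr fun l => ?_
  by_cases h : l = 0
  · simp [h]
  · simp only [Equiv.neg_apply, NegMemClass.coe_neg, neg_eq_zero, ZeroMemClass.coe_eq_zero, h,
      if_false]
    rw [show -z - -l.1 = -(z - l.1) by ring, div_neg, div_neg, neg_sq]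
    ring

/-- The quasi-periods of the zeta function exist because its derivative `-℘` is periodic and the
complement of the lattice is connected. -/
theorem exists_quasiPeriod (L : PeriodPair) {l : ℂ} (hl : l ∈ L.lattice) :
    ∃ η : ℂ, ∀ z ∉ L.lattice, weierstrassZeta L (z + l) = weierstrassZeta L z + η := by
  have hadd : ∀ {z : ℂ}, z ∉ L.lattice → z + l ∉ L.lattice := fun hz h =>
    hz (by simpa using sub_mem h hl)
  have hc : IsPreconnected ((L.lattice : Set ℂ)ᶜ) :=
    (Set.Countable.isConnected_compl_of_one_lt_rank (by simp)
      (countable_of_Lindelof_of_discrete (X := L.lattice))).2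
  obtain ⟨η, hη⟩ := L.isClosed_lattice.isOpen_compl.exists_eq_add_of_deriv_eq hc
    (f := fun z => weierstrassZeta L (z + l)) (g := weierstrassZeta L)
    (fun z hz => (DifferentiableAt.comp (f := fun z => z + l) z
      (analyticAt_weierstrassZeta L (hadd hz)).differentiableAt
      (by fun_prop)).differentiableWithinAt)
    (fun z hz => (analyticAt_weierstrassZeta L hz).differentiableAt.differentiableWithinAt)
    (fun z hz => by
      rw [deriv_comp_add_const, deriv_weierstrassZeta L (hadd hz), deriv_weierstrassZeta L hz]
      rw [L.weierstrassP_add_coe z ⟨l, hl⟩])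
  exact ⟨η, fun z hz => hη hz⟩

open Classical in
/-- The additive constant by which the zeta function changes under the period `l`; `0` if `l` is
not a period. -/
def quasiPeriod (L : PeriodPair) (l : ℂ) : ℂ :=
  if hl : l ∈ L.lattice then (exists_quasiPeriod L hl).choose else 0

theorem weierstrassZeta_add (L : PeriodPair) {l : ℂ} (hl : l ∈ L.lattice) {z : ℂ}
    (hz : z ∉ L.lattice) : weierstrassZeta L (z + l) = weierstrassZeta L z + quasiPeriod L l := by
  rw [quasiPeriod, dif_pos hl]
  exact (exists_quasiPeriod L hl).choose_spec z hz

/-- `(-1)^(j-1) / (j-1)! · ζ^(j-1)`, the function whose polar part at every lattice point `l` is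
`(z - l)^(-j)`; only `j ≥ 1` is meaningful. -/
def zetaBlock (L : PeriodPair) (j : ℕ) (z : ℂ) : ℂ :=
  (-1) ^ (j - 1) / ((j - 1).factorial : ℂ) * iteratedDeriv (j - 1) (weierstrassZeta L) z

theorem zetaBlock_one (L : PeriodPair) : zetaBlock L 1 = weierstrassZeta L := by
  funext z
  simp [zetaBlock]

theorem removable_iteratedDeriv_weierstrassZeta (L : PeriodPair) {l : ℂ} (hl : l ∈ L.lattice)
    (k : ℕ) : Removable (fun z => iteratedDeriv k (weierstrassZeta L) z -
      (-1) ^ k * (k.factorial : ℂ) * ((z - l) ^ (k + 1))⁻¹) l := by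
  induction k with
  | zero =>
    -- the quasi-periodicity moves the expansion at `0` to the lattice point `l`
    have h0 : Removable (fun z => zetaRegular L (z + -l) + quasiPeriod L l) l := by
      refine Removable.add (Removable.comp_add (u := zetaRegular L) ?_) analyticAt_const.removable
      rw [add_neg_cancel]
      exact (analyticAt_zetaRegular L (by simp)).removable
    refine h0.congr ?_
    filter_upwards [eventually_notMem_lattice L l] with z hz
    have hzl : z + -l ∉ L.lattice := fun h => hz (by simpa using add_mem h hl)
    have := weierstrassZeta_add L hl hzl
    rw [neg_add_cancel_right, weierstrassZeta_eq L (z + -l)] at this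
    rw [iteratedDeriv_zero, this]
    simp [sub_eq_add_neg]
    ring
  | succ k ih =>
    refine ih.deriv.congr ?_
    filter_upwards [eventually_notMem_lattice L l, self_mem_nhdsWithin] with z hz hzl
    have hzl : z - l ≠ 0 := sub_ne_zero.2 hzl
    have ha : AnalyticAt ℂ (iteratedDeriv k (weierstrassZeta L)) z :=
      analyticAt_iteratedDeriv_weierstrassZeta L hz k
    have h1 := ((((hasDerivAt_id z).sub_const l).pow (k + 1)).inv
      (pow_ne_zero _ hzl)).const_mul ((-1) ^ k * (k.factorial : ℂ))
    have h2 := ha.differentiableAt.hasDerivAt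
    rw [iteratedDeriv_succ]
    refine (h2.sub h1).deriv.trans ?_
    simp only [id, Nat.add_sub_cancel, Nat.factorial_succ, Pi.pow_apply]
    push_cast
    field_simp
    ring

theorem removable_zetaBlock_sub (L : PeriodPair) {l : ℂ} (hl : l ∈ L.lattice) {j : ℕ}
    (hj : 1 ≤ j) : Removable (fun z => zetaBlock L j z - ((z - l) ^ j)⁻¹) l := by
  obtain ⟨k, rfl⟩ := Nat.exists_eq_add_of_le' hj
  refine ((removable_iteratedDeriv_weierstrassZeta L hl k).const_mul
    ((-1) ^ k / (k.factorial : ℂ))).congr (.of_forall fun z => ?_)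
  have hk : (k.factorial : ℂ) ≠ 0 := Nat.cast_ne_zero.2 k.factorial_ne_zero
  have hs : ((-1 : ℂ) ^ k) * (-1) ^ k = 1 := by rw [← mul_pow]; simp
  simp only [zetaBlock, Nat.add_sub_cancel]
  rw [mul_sub]
  congr 1
  rw [show (-1 : ℂ) ^ k / k.factorial * ((-1) ^ k * k.factorial * ((z - l) ^ (k + 1))⁻¹) =
    ((-1 : ℂ) ^ k * (-1) ^ k) * (k.factorial / k.factorial) * ((z - l) ^ (k + 1))⁻¹ by ring,
    hs, div_self hk, one_mul, one_mul]

theorem analyticAt_zetaBlock (L : PeriodPair) {z : ℂ} (hz : z ∉ L.lattice) (j : ℕ) :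
    AnalyticAt ℂ (zetaBlock L j) z :=
  analyticAt_const.mul (analyticAt_iteratedDeriv_weierstrassZeta L hz _)

theorem meromorphic_weierstrassZeta (L : PeriodPair) : Meromorphic (weierstrassZeta L) := by
  intro x
  by_cases hx : x ∈ L.lattice
  · have h := (removable_zetaBlock_sub L hx le_rfl).meromorphicAt
    have h2 : MeromorphicAt (fun z : ℂ => ((z - x) ^ 1)⁻¹) x := by fun_prop
    have := h.add h2
    rw [zetaBlock_one] at this
    convert this using 1
    funext z
    simp
  · exact (analyticAt_weierstrassZeta L hx).meromorphicAt

theorem meromorphic_zetaBlock (L : PeriodPair) (j : ℕ) : Meromorphic (zetaBlock L j) := by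
  intro x
  have h : MeromorphicAt (iteratedDeriv (j - 1) (weierstrassZeta L)) x := by
    rw [iteratedDeriv_eq_iterate]
    exact (meromorphic_weierstrassZeta L x).iterated_deriv
  exact (MeromorphicAt.const _ x).mul h

/-- The blocks with `j ≥ 2` are periodic; the block `j = 1` is the zeta function itself. -/
theorem zetaBlock_add (L : PeriodPair) {l : ℂ} (hl : l ∈ L.lattice) {z : ℂ} (hz : z ∉ L.lattice)
    {j : ℕ} (hj : 1 ≤ j) :
    zetaBlock L j (z + l) = zetaBlock L j z + if j = 1 then quasiPeriod L l else 0 := by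
  rcases eq_or_lt_of_le hj with rfl | hj
  · simp [zetaBlock_one, weierstrassZeta_add L hl hz]
  · obtain ⟨k, rfl⟩ := Nat.exists_eq_add_of_le' hj
    rw [if_neg (by omega), add_zero, zetaBlock, zetaBlock]
    congr 1
    have he : (fun z => weierstrassZeta L (z + l)) =ᶠ[𝓝 z]
        fun z => weierstrassZeta L z + quasiPeriod L l := by
      filter_upwards [compl_lattice_mem_nhds L hz] with w hw
      exact weierstrassZeta_add L hl hw
    have h1 := he.iteratedDeriv_eq (k + 1)
    rw [iteratedDeriv_comp_add_const] at h1
    refine h1.trans ?_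
    rw [iteratedDeriv_succ', show k + Nat.succ 1 - 1 = k + 1 by omega, iteratedDeriv_succ',
      deriv_add_const']

theorem eventually_codiscrete_sub_notMem (L : PeriodPair) (a : ℂ) :
    ∀ᶠ z in codiscrete ℂ, z - a ∉ L.lattice := by
  rw [Filter.Eventually, mem_codiscrete]
  intro x
  rw [disjoint_principal_right, compl_compl]
  have ht : Tendsto (fun z : ℂ => z - a) (𝓝[≠] x) (𝓝[≠] (x - a)) := by
    refine tendsto_nhdsWithin_of_tendsto_nhds_of_eventually_within _ ?_ ?_
    · exact ((continuous_sub_right a).tendsto x).mono_left nhdsWithin_le_nhds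
    · filter_upwards [self_mem_nhdsWithin] with z hz
      simpa using hz
  exact ht.eventually (eventually_notMem_lattice L (x - a))

/-! ### No elliptic function has a single simple pole -/

theorem half_sum_notMem_lattice (L : PeriodPair) : L.ω₂ / 2 + L.ω₁ / 2 ∉ L.lattice := by
  have := (L.mul_ω₁_add_mul_ω₂_mem_lattice (α := 1 / 2) (β := 1 / 2)).not.mpr (by norm_num)
  convert this using 2
  push_cast
  ring

theorem ω₁_ne_zero (L : PeriodPair) : L.ω₁ ≠ 0 := fun h =>
  L.ω₁_div_two_notMem_lattice (by simp [h])

theorem eventuallyEq_const_of_removable_of_periodic {L : PeriodPair} {u : ℂ → ℂ}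
    (hu : ∀ x, Removable u x) (h₁ : Function.Periodic u L.ω₁) (h₂ : Function.Periodic u L.ω₂) :
    ∃ C : ℂ, u =ᶠ[codiscrete ℂ] fun _ => C := by
  obtain ⟨a, b, ha, -, hab⟩ := eq_affine_of_removable_of_quasiPeriodic (L := L) hu (c₁ := 0)
    (c₂ := 0) (.of_forall fun z => by simp [h₁ z]) (.of_forall fun z => by simp [h₂ z])
  have : a = 0 := (mul_eq_zero.1 ha).resolve_right (ω₁_ne_zero L)
  exact ⟨b, by simpa [this] using hab⟩

/-- The quasi-periods are not a multiple of the periods. Otherwise `F = ζ - a z` is odd and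
elliptic, hence vanishes at the half periods. Then `F(z) F(z + ω₁/2)` has no poles, so is constant,
and vanishes at `ω₂/2`, which is absurd. -/
theorem quasiPeriod_ne_mul (L : PeriodPair) (a : ℂ) (h₁ : quasiPeriod L L.ω₁ = a * L.ω₁)
    (h₂ : quasiPeriod L L.ω₂ = a * L.ω₂) : False := by
  classical
  set F : ℂ → ℂ := fun z => if z ∈ L.lattice then 0 else weierstrassZeta L z - a * z with hF
  have hper : ∀ l ∈ L.lattice, quasiPeriod L l = a * l → Function.Periodic F l := by
    intro l hl hq z
    have hiff : z + l ∈ L.lattice ↔ z ∈ L.lattice :=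
      ⟨fun h => by simpa using sub_mem h hl, fun h => add_mem h hl⟩
    by_cases hz : z ∈ L.lattice
    · simp [hF, hiff, hz]
    · simp only [hF, hiff, hz, if_false]
      rw [weierstrassZeta_add L hl hz, hq]
      ring
  have hp₁ := hper _ L.ω₁_mem_lattice h₁
  have hp₂ := hper _ L.ω₂_mem_lattice h₂
  have hodd : ∀ z, F (-z) = -F z := by
    intro z
    by_cases hz : z ∈ L.lattice
    · simp [hF, hz]
    · simp only [hF, neg_mem_iff, hz, if_false]
      rw [weierstrassZeta_neg]
      ring
  have hhalf : ∀ w, Function.Periodic F w → F (w / 2) = 0 := by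
    intro w hw
    have h := hw (-(w / 2))
    rw [hodd, show -(w / 2) + w = w / 2 by ring] at h
    linear_combination (1 / 2 : ℂ) * h
  have hana : ∀ z ∉ L.lattice, AnalyticAt ℂ F z := by
    intro z hz
    refine ((analyticAt_weierstrassZeta L hz).sub
      (analyticAt_const.mul analyticAt_id : AnalyticAt ℂ (fun z => a * z) z)).congr ?_
    filter_upwards [compl_lattice_mem_nhds L hz] with w hw
    have hw : w ∉ L.lattice := hw
    simp [hF, hw]
  have hpole : ∀ l ∈ L.lattice, MeromorphicAt F l ∧ meromorphicOrderAt F l = (-1 : ℤ) := by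
    intro l hl
    have hr := (removable_zetaBlock_sub L hl le_rfl).sub
      (analyticAt_const.mul analyticAt_id : AnalyticAt ℂ (fun z => a * z) l).removable
    obtain ⟨g, hg, hgF⟩ := hr
    have hFg : F =ᶠ[𝓝[≠] l] fun z => (z - l) ^ (-1 : ℤ) • (1 + (z - l) * g z) := by
      filter_upwards [hgF, eventually_notMem_lattice L l, self_mem_nhdsWithin] with z hz hzL hzl
      have hzl : z - l ≠ 0 := sub_ne_zero.2 hzl
      simp only [hF, hzL, if_false]
      rw [← hz, zetaBlock_one]
      simp only [zpow_neg, zpow_one, pow_one, smul_eq_mul, Pi.mul_apply]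
      field_simp
      ring
    have hm : MeromorphicAt F l := by
      rw [MeromorphicAt.meromorphicAt_congr hFg]
      have := hg.meromorphicAt
      fun_prop
    refine ⟨hm, (meromorphicOrderAt_eq_int_iff hm).2 ⟨_, ?_, ?_, hFg⟩⟩
    · fun_prop
    · simp
  have hmero : Meromorphic F := fun z => by
    by_cases hz : z ∈ L.lattice
    · exact (hpole z hz).1
    · exact (hana z hz).meromorphicAt
  have hzero : ∀ z ∉ L.lattice, F z = 0 → 0 < meromorphicOrderAt F z := by
    intro z hz h0
    refine tendsto_zero_iff_meromorphicOrderAt_pos (hmero z) |>.1 ?_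
    simpa [h0] using (hana z hz).continuousAt.tendsto.mono_left nhdsWithin_le_nhds
  have hcancel : ∀ o : WithTop ℤ, 0 < o → 0 ≤ ((-1 : ℤ) : WithTop ℤ) + o := by
    intro o ho
    induction o with
    | top => simp
    | coe n =>
      rw [← WithTop.coe_add]
      have : 0 < n := by exact_mod_cast ho
      have : 0 ≤ -1 + n := by omega
      exact_mod_cast this
  have hmero' : Meromorphic fun z => F (z + L.ω₁ / 2) := fun z =>
    MeromorphicAt.comp_analyticAt (g := fun z => z + L.ω₁ / 2) (hmero _) (by fun_prop)
  have hord : ∀ z, meromorphicOrderAt (fun z => F z * F (z + L.ω₁ / 2)) z =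
      meromorphicOrderAt F z + meromorphicOrderAt F (z + L.ω₁ / 2) := by
    intro z
    rw [← meromorphicOrderAt_comp_add_const_eq_meromorphicOrderAt]
    exact meromorphicOrderAt_mul (hmero z) (hmero' z)
  have hmul : ∀ z, Removable (fun z => F z * F (z + L.ω₁ / 2)) z := by
    intro z
    refine ((hmero z).mul (hmero' z)).meromorphicOrderAt_nonneg_iff.1 ((hord z).symm ▸ ?_)
    by_cases hz : z ∈ L.lattice
    · rw [(hpole z hz).2]
      refine hcancel _ (hzero _ (fun h => L.ω₁_div_two_notMem_lattice ?_) ?_)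
      · simpa using sub_mem h hz
      · rw [add_comm, periodic_of_mem_lattice hp₁ hp₂ hz, hhalf _ hp₁]
    · by_cases hz' : z + L.ω₁ / 2 ∈ L.lattice
      · rw [(hpole _ hz').2, add_comm]
        refine hcancel _ (hzero _ hz ?_)
        have h := periodic_of_mem_lattice hp₁ hp₂ hz' (-(L.ω₁ / 2))
        rw [hodd, hhalf _ hp₁, neg_zero] at h
        rw [← h]
        congr 1
        ring
      · exact add_nonneg (hana z hz).meromorphicOrderAt_nonneg (hana _ hz').meromorphicOrderAt_nonneg
  obtain ⟨C, hC⟩ := eventuallyEq_const_of_removable_of_periodic (L := L) hmul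
    (fun z => by
      rw [hp₁, add_right_comm, hp₁])
    (fun z => by
      rw [hp₂, add_right_comm, hp₂])
  have hC0 : C = 0 := by
    have hc : ContinuousAt (fun z => F z * F (z + L.ω₁ / 2)) (L.ω₂ / 2) := by
      refine (hana _ L.ω₂_div_two_notMem_lattice).continuousAt.mul ?_
      exact ContinuousAt.comp (f := fun z => z + L.ω₁ / 2)
        (hana _ (half_sum_notMem_lattice L)).continuousAt (by fun_prop)
    have h := eq_of_eventuallyEq_codiscrete hC hc continuousAt_const
    simp only [hhalf _ hp₂, zero_mul] at h
    exact h.symm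
  have htop := hord 0
  rw [meromorphicOrderAt_eq_top_iff.2 (by
    filter_upwards [eventuallyEq_codiscrete_iff.1 hC 0] with z hz
    rw [hz, hC0]), (hpole 0 (zero_mem _)).2] at htop
  refine MeromorphicOn.meromorphicOrderAt_ne_top_of_isPreconnected (f := F) (U := Set.univ)
    (meromorphicOn_univ.2 hmero) isPreconnected_univ (Set.mem_univ 0) (y := 0 + L.ω₁ / 2)
    (Set.mem_univ _) ?_ ?_
  · rw [(hpole 0 (zero_mem _)).2]
    exact WithTop.coe_ne_top
  · exact (WithTop.add_eq_top.1 htop.symm).resolve_left WithTop.coe_ne_top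

/-! ### Pinned points and the poles of an elliptic function -/

variable {L : PeriodPair} {s : ℂ}

/-- The point `q_ω + n s` attached by a pinning to the pair `(ω, n)`. -/
abbrev AnalyticPinning.point (R : AnalyticPinning L s) (p : Orbit L s × ℤ) : ℂ :=
  R.rep p.1 + p.2 * s

theorem eq_zero_of_mul_mem_lattice (hs : s ∉ Submodule.span ℚ (L.lattice : Set ℂ)) {n : ℤ}
    (hn : n * s ∈ L.lattice) : n = 0 := by
  by_contra h
  refine hs ?_
  have := Submodule.smul_mem (Submodule.span ℚ (L.lattice : Set ℂ)) ((n : ℚ)⁻¹)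
    (Submodule.subset_span hn)
  have hn' : (n : ℂ) ≠ 0 := Int.cast_ne_zero.2 h
  rwa [Rat.smul_def, Rat.cast_inv, Rat.cast_intCast, inv_mul_cancel_left₀ hn'] at this

theorem mem_orbitSubgroup {x : ℂ} :
    x ∈ orbitSubgroup L s ↔ ∃ l ∈ L.lattice, ∃ n : ℤ, l + n * s = x := by
  simp only [orbitSubgroup, AddSubgroup.mem_sup, AddSubgroup.mem_zmultiples_iff,
    Submodule.mem_toAddSubgroup, zsmul_eq_mul]
  constructor
  · rintro ⟨l, hl, _, ⟨n, rfl⟩, rfl⟩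
    exact ⟨l, hl, n, rfl⟩
  · rintro ⟨l, hl, n, rfl⟩
    exact ⟨l, hl, _, ⟨n, rfl⟩, rfl⟩

theorem exists_sub_point_mem_lattice (R : AnalyticPinning L s) (x : ℂ) :
    ∃ p, x - R.point p ∈ L.lattice := by
  have h := R.mk_rep (QuotientAddGroup.mk x)
  obtain ⟨l, hl, n, hx⟩ := mem_orbitSubgroup.1 (QuotientAddGroup.eq.1 h)
  refine ⟨(QuotientAddGroup.mk x, n), ?_⟩
  convert hl using 1
  simp only [AnalyticPinning.point]
  linear_combination -hx

theorem point_injective_mod_lattice (hs : s ∉ Submodule.span ℚ (L.lattice : Set ℂ))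
    (R : AnalyticPinning L s) {p q : Orbit L s × ℤ} (h : R.point p - R.point q ∈ L.lattice) :
    p = q := by
  obtain ⟨ω, n⟩ := p
  obtain ⟨ω', m⟩ := q
  have hω : ω' = ω := by
    rw [← R.mk_rep ω, ← R.mk_rep ω']
    refine QuotientAddGroup.eq.2 (mem_orbitSubgroup.2 ⟨_, h, m - n, ?_⟩)
    simp only [AnalyticPinning.point]
    push_cast
    ring
  subst hω
  have : n - m = 0 := eq_zero_of_mul_mem_lattice hs (by
    convert h using 1
    simp only [AnalyticPinning.point]
    push_cast
    ring)
  rw [sub_eq_zero.1 this]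

theorem poleOrder_eq_zero {f : ℂ → ℂ} {x : ℂ} (hf : AnalyticAt ℂ f x) : poleOrder f x = 0 := by
  have h := hf.meromorphicOrderAt_nonneg
  rw [poleOrder]
  generalize meromorphicOrderAt f x = o at h ⊢
  induction o with
  | top => simp
  | coe n =>
    have : 0 ≤ n := by exact_mod_cast h
    simp only [WithTop.untop₀_coe]
    omega

theorem IsElliptic.periodic {f : ℂ → ℂ} (hf : IsElliptic L f) {l : ℂ} (hl : l ∈ L.lattice) :
    Function.Periodic f l :=
  periodic_of_mem_lattice hf.periodic_ω₁ hf.periodic_ω₂ hl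

theorem IsElliptic.poleOrder_add {f : ℂ → ℂ} (hf : IsElliptic L f) {l : ℂ} (hl : l ∈ L.lattice)
    (x : ℂ) : poleOrder f (x + l) = poleOrder f x := by
  rw [← poleOrder_comp_add, funext (hf.periodic hl)]

theorem IsElliptic.polarCoeff_add {f : ℂ → ℂ} (hf : IsElliptic L f) {l : ℂ} (hl : l ∈ L.lattice)
    (x : ℂ) (j : ℕ) : polarCoeff f (x + l) j = polarCoeff f x j := by
  rw [← polarCoeff_comp_add hf.meromorphic, funext (hf.periodic hl)]

/-- An elliptic function has finitely many poles modulo the lattice. -/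
theorem finite_poles (hs : s ∉ Submodule.span ℚ (L.lattice : Set ℂ)) (R : AnalyticPinning L s)
    {f : ℂ → ℂ} (hf : IsElliptic L f) : {p | poleOrder f (R.point p) ≠ 0}.Finite := by
  obtain ⟨r, hr⟩ := exists_lattice_sub_mem_closedBall L
  choose l hl hlr using fun p => hr (R.point p)
  have hK := isCompact_closedBall (0 : ℂ) r
  have hfin := hK.finite_sdiff_of_mem_codiscreteWithin
    (MeromorphicOn.analyticAt_mem_codiscreteWithin fun x _ => hf.meromorphic x)
  refine Set.Finite.of_finite_image (f := fun p => R.point p - l p) (hfin.subset ?_) ?_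
  · rintro _ ⟨p, hp, rfl⟩
    refine ⟨hlr p, fun ha => hp ?_⟩
    have : poleOrder f (R.point p - l p) = 0 := poleOrder_eq_zero ha
    rwa [sub_eq_add_neg, hf.poleOrder_add (neg_mem (hl p))] at this
  · intro p _ q _ hpq
    refine point_injective_mod_lattice hs R ?_
    have : R.point p - R.point q = l p - l q := by
      have hpq : R.point p - l p = R.point q - l q := hpq
      linear_combination hpq
    rw [this]
    exact sub_mem (hl p) (hl q)

theorem exists_poleOrder_bound {f : ℂ → ℂ} {R : AnalyticPinning L s} {T : Finset (Orbit L s × ℤ)}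
    (hT : ∀ p ∉ T, poleOrder f (R.point p) = 0) : ∃ N, ∀ p, poleOrder f (R.point p) ≤ N := by
  refine ⟨T.sup fun p => poleOrder f (R.point p), fun p => ?_⟩
  by_cases hp : p ∈ T
  · exact Finset.le_sup (f := fun p => poleOrder f (R.point p)) hp
  · simp [hT p hp]

/-! ### The expansion of an elliptic function in derivatives of the zeta function -/

theorem zetaBlock_sub_add {l : ℂ} (hl : l ∈ L.lattice) (b : ℂ) {j : ℕ} (hj : 1 ≤ j) :
    (fun z => zetaBlock L j (z + l - b)) =ᶠ[codiscrete ℂ]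
      fun z => zetaBlock L j (z - b) + if j = 1 then quasiPeriod L l else 0 := by
  filter_upwards [eventually_codiscrete_sub_notMem L b] with z hz
  rw [add_sub_right_comm, zetaBlock_add L hl hz hj]

theorem removable_zetaBlock {b x : ℂ} (h : x - b ∉ L.lattice) (j : ℕ) :
    Removable (fun z => zetaBlock L j (z - b)) x := by
  simp only [sub_eq_add_neg] at h ⊢
  exact (analyticAt_zetaBlock L h j).removable.comp_add

/-- The part of the expansion of `f` contributed by the pole `b`, where `N` is any bound for the
order of the pole. -/
def zetaPart (L : PeriodPair) (f : ℂ → ℂ) (N : ℕ) (b z : ℂ) : ℂ :=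
  ∑ j ∈ Finset.Icc 1 N, polarCoeff f b j * zetaBlock L j (z - b)

theorem removable_sub_zetaPart {f : ℂ → ℂ} (hf : IsElliptic L f) {N : ℕ} {b x : ℂ}
    (hN : poleOrder f b ≤ N) (h : x - b ∈ L.lattice) :
    Removable (fun z => f z - zetaPart L f N b z) x := by
  have hx : x = b + (x - b) := by ring
  have hpo : poleOrder f x = poleOrder f b := by rw [hx, hf.poleOrder_add h]
  have h1 := removable_sub_polarPart (hf.meromorphic x) (hpo.trans_le hN)
  have h2 : Removable (fun z => ∑ j ∈ Finset.Icc 1 N,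
      polarCoeff f b j * (zetaBlock L j (z - b) - ((z - x) ^ j)⁻¹)) x := by
    refine Removable.sum fun j hj => Removable.const_mul ?_ _
    have h3 : Removable (fun z => zetaBlock L j z - ((z - (x - b)) ^ j)⁻¹) (x + -b) := by
      rw [← sub_eq_add_neg]
      exact removable_zetaBlock_sub L h (Finset.mem_Icc.1 hj).1
    refine h3.comp_add.congr (.of_forall fun z => ?_)
    simp only [← sub_eq_add_neg, sub_sub_sub_cancel_right]
  refine (h1.sub h2).congr (.of_forall fun z => ?_)
  simp only [zetaPart, mul_sub, Finset.sum_sub_distrib]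
  have : ∀ j, polarCoeff f x j = polarCoeff f b j := fun j => by rw [hx, hf.polarCoeff_add h]
  simp only [this]
  ring

theorem zetaPart_add {f : ℂ → ℂ} {N : ℕ} (hN : 1 ≤ N) {l : ℂ} (hl : l ∈ L.lattice) (b : ℂ) :
    (fun z => zetaPart L f N b (z + l)) =ᶠ[codiscrete ℂ]
      fun z => zetaPart L f N b z + polarCoeff f b 1 * quasiPeriod L l := by
  have h : ∀ᶠ z in codiscrete ℂ, ∀ j ∈ Finset.Icc 1 N, zetaBlock L j (z + l - b) =
      zetaBlock L j (z - b) + if j = 1 then quasiPeriod L l else 0 := by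
    rw [eventually_all_finset]
    exact fun j hj => zetaBlock_sub_add hl b (Finset.mem_Icc.1 hj).1
  filter_upwards [h] with z hz
  rw [zetaPart, Finset.sum_congr rfl fun j hj => by rw [hz j hj, mul_add],
    Finset.sum_add_distrib, zetaPart]
  congr 1
  rw [Finset.sum_eq_single 1]
  · simp
  · intro j _ hj
    simp [hj]
  · intro h
    exact absurd (Finset.mem_Icc.2 ⟨le_rfl, hN⟩) h

theorem exists_zeta_expansion (hs : s ∉ Submodule.span ℚ (L.lattice : Set ℂ))
    (R : AnalyticPinning L s) {f : ℂ → ℂ} (hf : IsElliptic L f) {T : Finset (Orbit L s × ℤ)}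
    (hT : ∀ p ∉ T, poleOrder f (R.point p) = 0) {N : ℕ} (hN1 : 1 ≤ N)
    (hN : ∀ p, poleOrder f (R.point p) ≤ N) :
    ∃ C : ℂ, f =ᶠ[codiscrete ℂ] fun z => C + ∑ p ∈ T, zetaPart L f N (R.point p) z := by
  classical
  set h : ℂ → ℂ := fun z => f z - ∑ p ∈ T, zetaPart L f N (R.point p) z with hh
  have hrem : ∀ x, Removable h x := by
    intro x
    obtain ⟨p, hp⟩ := exists_sub_point_mem_lattice R x
    -- only the part attached to `p` is singular at `x`; it is zero when `p ∉ T`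
    have h1 := removable_sub_zetaPart hf (hN p) hp
    have h2 : Removable (fun z => ∑ q ∈ T.erase p, zetaPart L f N (R.point q) z) x := by
      refine Removable.sum fun q hq => Removable.sum fun j _ =>
        (removable_zetaBlock (fun hx => (Finset.mem_erase.1 hq).1 ?_) j).const_mul _
      refine point_injective_mod_lattice hs R ?_
      have := sub_mem hp hx
      rwa [sub_sub_sub_cancel_left] at this
    refine (h1.sub h2).congr (.of_forall fun z => ?_)
    simp only [hh]
    by_cases hpT : p ∈ T
    · rw [← Finset.add_sum_erase T _ hpT]
      ring
    · have h0 : zetaPart L f N (R.point p) z = 0 := by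
        refine Finset.sum_eq_zero fun j hj => ?_
        rw [polarCoeff_of_lt, zero_mul]
        have := (Finset.mem_Icc.1 hj).1
        rw [hT p hpT]
        omega
      rw [Finset.erase_eq_of_notMem hpT, h0]
      ring
  set ρ : ℂ := ∑ p ∈ T, polarCoeff f (R.point p) 1 with hρ
  have hquasi : ∀ l ∈ L.lattice, (fun z => h (z + l)) =ᶠ[codiscrete ℂ]
      fun z => h z + -(ρ * quasiPeriod L l) := by
    intro l hl
    have h1 : ∀ᶠ z in codiscrete ℂ, ∀ p ∈ T, zetaPart L f N (R.point p) (z + l) =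
        zetaPart L f N (R.point p) z + polarCoeff f (R.point p) 1 * quasiPeriod L l := by
      rw [eventually_all_finset]
      exact fun p _ => zetaPart_add hN1 hl _
    filter_upwards [h1] with z hz
    simp only [hh]
    rw [Finset.sum_congr rfl hz, Finset.sum_add_distrib, ← Finset.sum_mul, hf.periodic hl]
    ring
  obtain ⟨a, b, ha₁, ha₂, hab⟩ := eq_affine_of_removable_of_quasiPeriodic (L := L) hrem
    (hquasi _ L.ω₁_mem_lattice) (hquasi _ L.ω₂_mem_lattice)
  -- the sum of the residues vanishes
  have hρ0 : ρ = 0 := by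
    by_contra hne
    refine quasiPeriod_ne_mul L (-(a / ρ)) ?_ ?_
    · field_simp
      linear_combination ha₁
    · field_simp
      linear_combination ha₂
  have ha : a = 0 := by
    rw [hρ0, zero_mul, neg_zero] at ha₁
    exact (mul_eq_zero.1 ha₁).resolve_right (ω₁_ne_zero L)
  refine ⟨b, ?_⟩
  filter_upwards [hab] with z hz
  simp only [hh, ha] at hz
  linear_combination hz

/-! ### Summable functions -/

/-- `u` is summable: off a discrete set, it has the form `τ(g) - g` with `g` elliptic. -/
def IsSummable (L : PeriodPair) (s : ℂ) (u : ℂ → ℂ) : Prop :=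
  ∃ g : ℂ → ℂ, IsElliptic L g ∧ u =ᶠ[codiscrete ℂ] fun z => shift s g z - g z

namespace IsSummable

variable {u v : ℂ → ℂ}

theorem congr (hu : IsSummable L s u) (h : u =ᶠ[codiscrete ℂ] v) : IsSummable L s v := by
  obtain ⟨g, hg, hug⟩ := hu
  exact ⟨g, hg, h.symm.trans hug⟩

theorem zero : IsSummable L s fun _ => 0 :=
  ⟨fun _ => 0, ⟨fun x => .const 0 x, fun _ => rfl, fun _ => rfl⟩, .of_forall fun z => by
    simp [shift]⟩

theorem add (hu : IsSummable L s u) (hv : IsSummable L s v) :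
    IsSummable L s fun z => u z + v z := by
  obtain ⟨g, hg, hug⟩ := hu
  obtain ⟨k, hk, hvk⟩ := hv
  refine ⟨fun z => g z + k z, ⟨fun x => (hg.1 x).add (hk.1 x), fun z => ?_, fun z => ?_⟩, ?_⟩
  · simp only [hg.2 z, hk.2 z]
  · simp only [hg.3 z, hk.3 z]
  · filter_upwards [hug, hvk] with z h1 h2
    simp only [h1, h2, shift]
    ring

theorem const_mul (hu : IsSummable L s u) (c : ℂ) : IsSummable L s fun z => c * u z := by
  obtain ⟨g, hg, hug⟩ := hu
  refine ⟨fun z => c * g z, ⟨fun x => (MeromorphicAt.const c x).mul (hg.1 x), fun z => ?_,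
    fun z => ?_⟩, ?_⟩
  · simp only [hg.2 z]
  · simp only [hg.3 z]
  · filter_upwards [hug] with z h1
    simp only [h1, shift]
    ring

theorem sub (hu : IsSummable L s u) (hv : IsSummable L s v) :
    IsSummable L s fun z => u z - v z :=
  (hu.add (hv.const_mul (-1))).congr (.of_forall fun z => by ring)

theorem sum {ι : Type*} {t : Finset ι} {F : ι → ℂ → ℂ} (h : ∀ i ∈ t, IsSummable L s (F i)) :
    IsSummable L s fun z => ∑ i ∈ t, F i z := by
  classical
  induction t using Finset.induction_on with
  | empty => simpa using zero
  | insert a t ha ih =>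
    simp only [Finset.sum_insert ha]
    exact (h a (by simp)).add (ih fun i hi => h i (by simp [hi]))

/-- `τ⁻¹(ψ) - ψ` is summable when `ψ` is meromorphic, and elliptic off a discrete set. Passing to
the normal form makes `ψ` periodic everywhere. -/
theorem sub_shift {ψ : ℂ → ℂ} (hψ : Meromorphic ψ)
    (h₁ : (fun z => ψ (z + L.ω₁)) =ᶠ[codiscrete ℂ] ψ)
    (h₂ : (fun z => ψ (z + L.ω₂)) =ᶠ[codiscrete ℂ] ψ) :
    IsSummable L s fun z => ψ (z - s) - ψ z := by
  have hG := eq_normalForm hψ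
  refine ⟨fun z => -normalForm ψ (z - s), ⟨fun x => ?_, fun z => ?_, fun z => ?_⟩, ?_⟩
  · exact (MeromorphicAt.comp_analyticAt (g := fun z => z - s)
      (meromorphic_normalForm ψ _) (by fun_prop)).neg
  · rw [add_sub_right_comm, normalForm_periodic hψ h₁]
  · rw [add_sub_right_comm, normalForm_periodic hψ h₂]
  · have hG' := eventuallyEq_codiscrete_comp_add hG (-s)
    simp only [← sub_eq_add_neg] at hG'
    filter_upwards [hG, hG'] with z h1 h2
    rw [h1, h2, shift, add_sub_cancel_right]
    ring

theorem of_forall_sub {v : ℤ → ℂ → ℂ} (h0 : IsSummable L s (v 0))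
    (h : ∀ n, IsSummable L s fun z => v (n + 1) z - v n z) (n : ℤ) : IsSummable L s (v n) := by
  induction n using Int.induction_on with
  | zero => exact h0
  | succ i ih => exact (ih.add (h i)).congr (.of_forall fun z => by ring)
  | pred i ih =>
    refine (ih.sub (h (-i - 1))).congr (.of_forall fun z => ?_)
    rw [sub_add_cancel]
    ring

end IsSummable

/-- Moving the pole `q + n s` of a block to `q` costs a summable function and, for `j = 1`, the
multiple `n (ζ(z - s) - ζ(z))`. The difference of this statement for `n + 1` and `n` is
`ψ(z - s) - ψ(z)`, where `ψ` is the block with pole `q + n s`, minus `ζ` if `j = 1`, which is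
elliptic. -/
theorem isSummable_zetaBlock_sub (q : ℂ) {j : ℕ} (hj : 1 ≤ j) (n : ℤ) :
    IsSummable L s fun z => zetaBlock L j (z - (q + n * s)) - zetaBlock L j (z - q) -
      if j = 1 then n * (weierstrassZeta L (z - s) - weierstrassZeta L z) else 0 := by
  refine IsSummable.of_forall_sub (v := fun (n : ℤ) z =>
    zetaBlock L j (z - (q + n * s)) - zetaBlock L j (z - q) -
      if j = 1 then n * (weierstrassZeta L (z - s) - weierstrassZeta L z) else 0) ?_ ?_ n
  · refine IsSummable.zero.congr (.of_forall fun z => ?_)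
    simp
  intro n
  set ψ : ℂ → ℂ := fun z => zetaBlock L j (z - (q + n * s)) -
    if j = 1 then weierstrassZeta L z else 0 with hψ
  have hper : ∀ l ∈ L.lattice, (fun z => ψ (z + l)) =ᶠ[codiscrete ℂ] ψ := by
    intro l hl
    filter_upwards [zetaBlock_sub_add hl (q + n * s) hj,
      eventually_codiscrete_sub_notMem L 0] with z h1 h2
    rw [sub_zero] at h2
    simp only [hψ, h1]
    split_ifs with h
    · rw [weierstrassZeta_add L hl h2]
      ring
    · ring
  have hm : Meromorphic ψ := by
    intro x
    refine MeromorphicAt.sub (MeromorphicAt.comp_analyticAt (g := fun z => z - (q + n * s))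
      (meromorphic_zetaBlock L j _) (by fun_prop)) ?_
    split_ifs
    · exact meromorphic_weierstrassZeta L x
    · exact .const 0 x
  refine (IsSummable.sub_shift hm (hper _ L.ω₁_mem_lattice) (hper _ L.ω₂_mem_lattice)).congr
    (.of_forall fun z => ?_)
  simp only [hψ]
  rw [show z - s - (q + n * s) = z - (q + (n + 1 : ℤ) * s) by push_cast; ring]
  split_ifs
  · push_cast
    ring
  · ring

/-! ### The sums over orbits -/

theorem finsum_one_le_eq_sum {F : ℕ → ℂ} {N : ℕ} (h : ∀ j, 1 ≤ j → F j ≠ 0 → j ≤ N) :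
    ∑ᶠ (j : ℕ) (_ : 1 ≤ j), F j = ∑ j ∈ Finset.Icc 1 N, F j := by
  refine finsum_mem_eq_sum_of_subset (s := {j | 1 ≤ j}) F ?_ ?_
  · rintro j ⟨h1, h2⟩
    exact Finset.mem_coe.2 (Finset.mem_Icc.2 ⟨h1, h j h1 h2⟩)
  · intro j hj
    exact (Finset.mem_Icc.1 (Finset.mem_coe.1 hj)).1

theorem finsum_eq_sum_of_forall_notMem {ι : Type*} {F : ι → ℂ} {t : Finset ι}
    (h : ∀ i ∉ t, F i = 0) : ∑ᶠ i, F i = ∑ i ∈ t, F i := by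
  refine finsum_eq_sum_of_support_subset F fun i hi => ?_
  by_contra hit
  exact hi (h i hit)

theorem polarCoeff_eq_zero_of_notMem {f : ℂ → ℂ} {R : AnalyticPinning L s}
    {Ω : Finset (Orbit L s)} {Z : Finset ℤ}
    (hT : ∀ p ∉ Ω ×ˢ Z, poleOrder f (R.point p) = 0) {ω : Orbit L s} {n : ℤ}
    (h : ¬(ω ∈ Ω ∧ n ∈ Z)) {j : ℕ} (hj : 1 ≤ j) : polarCoeff f (R.rep ω + n * s) j = 0 := by
  refine polarCoeff_of_lt ?_
  have := hT (ω, n) fun hp => h (Finset.mem_product.1 hp)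
  simp only [AnalyticPinning.point] at this
  omega

theorem zetaSum_eq_sum {f : ℂ → ℂ} {R : AnalyticPinning L s} {Ω : Finset (Orbit L s)}
    {Z : Finset ℤ} (hT : ∀ p ∉ Ω ×ˢ Z, poleOrder f (R.point p) = 0) {N : ℕ}
    (hN : ∀ p, poleOrder f (R.point p) ≤ N) (z : ℂ) :
    zetaSum R f z = ∑ p ∈ Ω ×ˢ Z, zetaPart L f N (R.point p) z := by
  have hterm : ∀ (ω : Orbit L s) (n : ℤ),
      ∑ᶠ (j : ℕ) (_ : 1 ≤ j), polarCoeff f (R.rep ω + n * s) j * (-1) ^ (j - 1) /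
        ((j - 1).factorial : ℂ) * iteratedDeriv (j - 1) (weierstrassZeta L) (z - R.rep ω - n * s) =
      zetaPart L f N (R.rep ω + n * s) z := by
    intro ω n
    rw [finsum_one_le_eq_sum (N := N), zetaPart]
    · refine Finset.sum_congr rfl fun j _ => ?_
      rw [zetaBlock, sub_sub]
      ring
    · intro j _ h
      by_contra hj
      refine h ?_
      rw [polarCoeff_of_lt ((hN (ω, n)).trans_lt (not_le.1 hj))]
      simp
  have hzero : ∀ ω n, ¬(ω ∈ Ω ∧ n ∈ Z) → zetaPart L f N (R.rep ω + n * s) z = 0 := by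
    intro ω n h
    refine Finset.sum_eq_zero fun j hj => ?_
    rw [polarCoeff_eq_zero_of_notMem hT h (Finset.mem_Icc.1 hj).1, zero_mul]
  simp only [zetaSum, hterm]
  rw [Finset.sum_product, finsum_eq_sum_of_forall_notMem (t := Ω)]
  · refine Finset.sum_congr rfl fun ω _ => ?_
    rw [finsum_eq_sum_of_forall_notMem (t := Z)]
    exact fun n hn => hzero ω n fun h => hn h.2
  · intro ω hω
    simp only [hzero ω _ fun h => hω h.1, finsum_zero]

theorem pano₁_eq_sum {f : ℂ → ℂ} {R : AnalyticPinning L s} {Ω : Finset (Orbit L s)}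
    {Z : Finset ℤ} (hT : ∀ p ∉ Ω ×ˢ Z, poleOrder f (R.point p) = 0) :
    pano₁ R f = ∑ p ∈ Ω ×ˢ Z, (p.2 : ℂ) * polarCoeff f (R.point p) 1 := by
  have hzero : ∀ ω n, ¬(ω ∈ Ω ∧ n ∈ Z) → (n : ℂ) * polarCoeff f (R.rep ω + n * s) 1 = 0 := by
    intro ω n h
    rw [polarCoeff_eq_zero_of_notMem hT h le_rfl, mul_zero]
  rw [pano₁, Finset.sum_product, finsum_eq_sum_of_forall_notMem (t := Ω)]
  · refine Finset.sum_congr rfl fun ω _ => ?_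
    rw [finsum_eq_sum_of_forall_notMem (t := Z)]
    exact fun n hn => hzero ω n fun h => hn h.2
  · intro ω hω
    simp only [hzero ω _ fun h => hω h.1, finsum_zero]

/-- Orbital residues may be computed with the pinned representatives: two representatives of an
orbit differ by a period and a shift of the summation index. -/
theorem ores_eq_finsum_rep {f : ℂ → ℂ} (hf : IsElliptic L f) (R : AnalyticPinning L s)
    (ω : Orbit L s) (j : ℕ) : ores f ω j = ∑ᶠ n : ℤ, polarCoeff f (R.rep ω + n * s) j := by
  have h : (QuotientAddGroup.mk ω.out : Orbit L s) = QuotientAddGroup.mk (R.rep ω) := by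
    rw [R.mk_rep]
    exact Quotient.out_eq ω
  obtain ⟨l, hl, m, hx⟩ := mem_orbitSubgroup.1 (QuotientAddGroup.eq.1 h)
  rw [ores, ← finsum_comp_equiv (Equiv.addRight m)]
  refine finsum_congr fun n => ?_
  rw [← hf.polarCoeff_add hl]
  congr 1
  simp only [Equiv.coe_addRight]
  push_cast
  linear_combination hx

theorem finsum_ores_eq_sum {f : ℂ → ℂ} (hf : IsElliptic L f) {R : AnalyticPinning L s}
    {Ω : Finset (Orbit L s)} {Z : Finset ℤ}
    (hT : ∀ p ∉ Ω ×ˢ Z, poleOrder f (R.point p) = 0) {N : ℕ}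
    (hN : ∀ p, poleOrder f (R.point p) ≤ N) (z : ℂ) :
    ∑ᶠ (ω : Orbit L s) (j : ℕ) (_ : 1 ≤ j),
      ores f ω j * (-1) ^ (j - 1) / ((j - 1).factorial : ℂ) *
        iteratedDeriv (j - 1) (weierstrassZeta L) (z - R.rep ω) =
      ∑ p ∈ Ω ×ˢ Z, ∑ j ∈ Finset.Icc 1 N,
        polarCoeff f (R.point p) j * zetaBlock L j (z - R.rep p.1) := by
  have hores : ∀ ω j, 1 ≤ j → ores f ω j = ∑ n ∈ Z, polarCoeff f (R.rep ω + n * s) j := by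
    intro ω j hj
    rw [ores_eq_finsum_rep hf R, finsum_eq_sum_of_forall_notMem]
    exact fun n hn => polarCoeff_eq_zero_of_notMem hT (fun h => hn h.2) hj
  have hterm : ∀ ω : Orbit L s, ∑ᶠ (j : ℕ) (_ : 1 ≤ j),
      ores f ω j * (-1) ^ (j - 1) / ((j - 1).factorial : ℂ) *
        iteratedDeriv (j - 1) (weierstrassZeta L) (z - R.rep ω) =
      ∑ n ∈ Z, ∑ j ∈ Finset.Icc 1 N,
        polarCoeff f (R.rep ω + n * s) j * zetaBlock L j (z - R.rep ω) := by
    intro ω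
    rw [finsum_one_le_eq_sum (N := N), Finset.sum_comm]
    · refine Finset.sum_congr rfl fun j hj => ?_
      rw [hores ω j (Finset.mem_Icc.1 hj).1, ← Finset.sum_mul, zetaBlock]
      ring
    · intro j hj h
      by_contra hjN
      refine h ?_
      rw [hores ω j hj, Finset.sum_eq_zero fun n _ =>
        polarCoeff_of_lt ((hN (ω, n)).trans_lt (not_le.1 hjN))]
      simp
  simp only [hterm]
  rw [Finset.sum_product, finsum_eq_sum_of_forall_notMem (t := Ω)]
  intro ω hω
  refine Finset.sum_eq_zero fun n _ => Finset.sum_eq_zero fun j hj => ?_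
  rw [polarCoeff_eq_zero_of_notMem hT (fun h => hω h.1) (Finset.mem_Icc.1 hj).1, zero_mul]

theorem isSummable_sum_zetaPart_sub (f : ℂ → ℂ) (R : AnalyticPinning L s)
    (T : Finset (Orbit L s × ℤ)) {N : ℕ} (hN : 1 ≤ N) :
    IsSummable L s fun z => ∑ p ∈ T, zetaPart L f N (R.point p) z -
      ((∑ p ∈ T, (p.2 : ℂ) * polarCoeff f (R.point p) 1) *
          (weierstrassZeta L (z - s) - weierstrassZeta L z) +
        ∑ p ∈ T, ∑ j ∈ Finset.Icc 1 N,
          polarCoeff f (R.point p) j * zetaBlock L j (z - R.rep p.1)) := by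
  have h : IsSummable L s fun z => ∑ p ∈ T, ∑ j ∈ Finset.Icc 1 N, polarCoeff f (R.point p) j *
      (zetaBlock L j (z - R.point p) - zetaBlock L j (z - R.rep p.1) -
        if j = 1 then p.2 * (weierstrassZeta L (z - s) - weierstrassZeta L z) else 0) :=
    .sum fun p _ => .sum fun j hj =>
      (isSummable_zetaBlock_sub (R.rep p.1) (Finset.mem_Icc.1 hj).1 p.2).const_mul _
  refine h.congr (.of_forall fun z => ?_)
  have h1 : 1 ∈ Finset.Icc 1 N := Finset.mem_Icc.2 ⟨le_rfl, hN⟩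
  simp only [mul_sub, mul_ite, mul_zero, Finset.sum_sub_distrib, Finset.sum_ite_eq', h1, if_true,
    Finset.sum_mul, zetaPart]
  have h2 : ∀ c : ℂ, ∑ p ∈ T, polarCoeff f (R.point p) 1 * (p.2 * c) =
      ∑ p ∈ T, p.2 * polarCoeff f (R.point p) 1 * c := fun c =>
    Finset.sum_congr rfl fun p _ => by ring
  rw [h2, h2]
  ring

end EllipticSummability
end

open EllipticSummability
theorem mainTheorem2 (L : PeriodPair) (s : ℂ)
    (hs : s ∉ Submodule.span ℚ (L.lattice : Set ℂ))
    (R : AnalyticPinning L s) (f : ℂ → ℂ) (hf : IsElliptic L f) :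
    -- only finitely many coefficients are nonzero, so that all the sums below are finite
    {p : Orbit L s × ℤ × ℕ |
      1 ≤ p.2.2 ∧ polarCoeff f (R.rep p.1 + p.2.1 * s) p.2.2 ≠ 0}.Finite ∧
    -- the pinned zeta-expansion of `f`, whose constant term is the panorbital residue of order 0
    f =ᶠ[Filter.codiscrete ℂ] (fun z => zetaConst R f + zetaSum R f z) ∧
    -- the reduction
    ∃ g : ℂ → ℂ, IsElliptic L g ∧
      (fun z => f z - (shift s g z - g z)) =ᶠ[Filter.codiscrete ℂ] fun z =>
        pano₀ R f + pano₁ R f * (weierstrassZeta L (z - s) - weierstrassZeta L z) +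
          ∑ᶠ (ω : Orbit L s) (j : ℕ) (_ : 1 ≤ j),
            ores f ω j * (-1) ^ (j - 1) / ((j - 1).factorial : ℂ) *
              iteratedDeriv (j - 1) (weierstrassZeta L) (z - R.rep ω) := by
  classical
  -- a finite box of pairs `(ω, n)` that contains all the poles
  obtain ⟨Ω, Z, hT⟩ : ∃ (Ω : Finset (Orbit L s)) (Z : Finset ℤ),
      ∀ p ∉ Ω ×ˢ Z, poleOrder f (R.point p) = 0 := by
    have hfin := finite_poles hs R hf
    refine ⟨hfin.toFinset.image Prod.fst, hfin.toFinset.image Prod.snd, fun p hp => ?_⟩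
    by_contra h
    have hp' : p ∈ hfin.toFinset := hfin.mem_toFinset.2 h
    exact hp (Finset.mem_product.2 ⟨Finset.mem_image_of_mem _ hp', Finset.mem_image_of_mem _ hp'⟩)
  obtain ⟨N, hN1, hN⟩ : ∃ N, 1 ≤ N ∧ ∀ p, poleOrder f (R.point p) ≤ N := by
    obtain ⟨N, hN⟩ := exists_poleOrder_bound hT
    exact ⟨N + 1, by omega, fun p => (hN p).trans (Nat.le_succ N)⟩
  have hsum : ∀ z, zetaSum R f z = ∑ p ∈ Ω ×ˢ Z, zetaPart L f N (R.point p) z :=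
    zetaSum_eq_sum hT hN
  have hexp : f =ᶠ[Filter.codiscrete ℂ] fun z => zetaConst R f + zetaSum R f z := by
    obtain ⟨C, hC⟩ := exists_zeta_expansion hs R hf hT hN1 hN
    exact Classical.epsilon_spec
      (p := fun C : ℂ => f =ᶠ[Filter.codiscrete ℂ] fun z => C + zetaSum R f z)
      ⟨C, by simpa only [hsum] using hC⟩
  refine ⟨?_, hexp, ?_⟩
  · refine (Ω ×ˢ Z ×ˢ Finset.Icc 1 N).finite_toSet.subset ?_
    rintro ⟨ω, n, j⟩ ⟨hj, hne⟩
    have hmem : ω ∈ Ω ∧ n ∈ Z := by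
      by_contra h
      exact hne (polarCoeff_eq_zero_of_notMem hT h hj)
    have hjN : j ≤ N := by
      by_contra h
      exact hne (polarCoeff_of_lt ((hN (ω, n)).trans_lt (not_le.1 h)))
    simpa using ⟨hmem.1, hmem.2, hj, hjN⟩
  · obtain ⟨g, hg, hgu⟩ := isSummable_sum_zetaPart_sub f R (Ω ×ˢ Z) hN1
    refine ⟨g, hg, ?_⟩
    filter_upwards [hexp, hgu] with z h1 h2
    rw [finsum_ores_eq_sum hf hT hN, pano₁_eq_sum hT, pano₀, ← h2, h1, hsum]
    ring
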